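/- **Setting.** Let $d\ge 0$, $k\ge 0$ be integers, $B>0$, and let $(\Omega,\mathcal A,P)$ be a probability space. Let $K_{kc}(\mathbb R^d)$ be the set of nonempty compact convex subsets of $\mathbb R^d$, and $K_{kc}^B(\mathbb R^d)$ the set of those $F\in K_{kc}(\mathbb R^d)$ with $\sup_{f\in F}\|f\|\le B$. For $F\in K_{kc}(\mathbb R^d)$ let $s(p,F)=\sup_{f\in F}\langle p,f\rangle$ ($p\in\mathbb S^{d-1}$) be its support function, let $\Psi(F)=s(\cdot,F)\in L^2(\mathbb S^{d-1})$ (with respect to surface measure), and put $$d_{kc}(F,G)=\Big(\int_{\mathbb S^{d-1}}\{s(p,F)-s(p,G)\}^2\,dp\Big)^{1/2}.$$ For a set-valued map $G$ on $\Omega$, the Aumann mean $\mathbb E[G]$ is the set of all $\mathbb E[f]$, where $f$ runs through the integrable measurable selections of $G$. Let $F:\Omega\to K_{kc}^B(\mathbb R^d)$ be a measurable set-valued map ($\{\omega: F(\omega)\cap C\ne\emptyset\}\in\mathcal A$ for every closed $C$), and let $X$ be a square integrable random vector with values in a set $\mathcal X\subseteq\mathbb R^k$ (for instance $\mathcal X$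 compact), with mean $\mu=\mathbb E[X]$ and invertible covariance matrix $\Sigma=\mathbb E[(X-\mu)(X-\mu)']$. Fix $x\in\mathbb R^k$, let $w(x,z)=1+(x-\mu)'\Sigma^{-1}(z-\mu)$, and let $$m_{\oplus,\Psi}(x)=\mathbb E[w(x,X)\Psi(F)]\in L^2(\mathbb S^{d-1}).$$ **Proposition.** The expectation defining $m_{\oplus,\Psi}(x)$ exists, and $m_{\oplus,\Psi}(x)$ is the unique minimizer of $h\mapsto\mathbb E[w(x,X)\|h-\Psi(F)\|_2^2]$ over $L^2(\mathbb S^{d-1})$, the latter expectations being finite for every $h$. The projection $$\widetilde m_{\oplus,\Psi}(x)=\operatorname*{argmin}_{h\in\Psi(K_{kc}^B(\mathbb R^d))}\|h-m_{\oplus,\Psi}(x)\|_2$$ exists and is unique, and there is exactly one $m_\oplus(x)\in K_{kc}^B(\mathbb R^d)$ with $\Psi(m_\oplus(x))=\widetilde m_{\oplus,\Psi}(x)$. This set $m_\oplus(x)=\Psi^{-1}(\widetilde m_{\oplus,\Psi}(x))$ is the global Fréchet regression function: it is the unique minimizer of $\nu\mapsto\mathbb E[w(x,X)\,d_{kc}^2(\nu,F)]$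 over $\nu\in K_{kc}^B(\mathbb R^d)$, these expectations being finite. Additionally, suppose that $\sup_{z\in\mathcal X}|w(x,z)|<\infty$. If $m_{\oplus,\Psi}(x)\in\Psi(K_{kc}^B(\mathbb R^d))$, then $m_\oplus(x)\subset\mathbb E[w(x,X)F]$. More generally, if $m_{\oplus,\Psi}(x)=\Psi(A)$ with $A\in K_{kc}(\mathbb R^d)$, then $A\subset\mathbb E[w(x,X)F]$. -/

import Mathlib

open MeasureTheory
open scoped Pointwise Matrix

noncomputable section

namespace FrechetRS

/-- Euclidean space `ℝ^d`. -/
abbrev Euc (d : ℕ) : Type := EuclideanSpace ℝ (Fin d)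

/-- The unit sphere of `ℝ^d`. -/
abbrev Sph (d : ℕ) : Type := Metric.sphere (0 : Euc d) 1

/-- The surface measure on the unit sphere of `ℝ^d` (two unit point masses if `d = 1`). -/
def surf (d : ℕ) : Measure (Sph d) := (volume : Measure (Euc d)).toSphere

instance (d : ℕ) : IsFiniteMeasure (surf d) := by
  unfold surf; infer_instance

/-- The Hilbert space of square integrable functions on the unit sphere. -/
abbrev L2Sph (d : ℕ) : Type := Lp ℝ 2 (surf d)

/-- The support function `s(p, F)`, the supremum of `⟨p, f⟩` over `f ∈ F`.
The nonempty compact convex subsets `F` of `ℝ^d` are the terms of `ConvexBody (Euc d)`. -/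
def supp {d : ℕ} (F : ConvexBody (Euc d)) (p : Sph d) : ℝ :=
  sSup ((fun f : Euc d => inner ℝ (p : Euc d) f) '' (F : Set (Euc d)))

/-- The distance `d_kc(F, G)`, the `L²` distance of the support functions. -/
def dkc {d : ℕ} (F G : ConvexBody (Euc d)) : ℝ :=
  Real.sqrt (∫ p, (supp F p - supp G p) ^ 2 ∂(surf d))

/-- The nonempty compact convex sets contained in the closed ball of radius `B` around `0`. -/
def KB (d : ℕ) (B : ℝ) : Set (ConvexBody (Euc d)) :=
  {F | ∀ f ∈ (F : Set (Euc d)), ‖f‖ ≤ B}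

theorem supp_le_add {d : ℕ} (F : ConvexBody (Euc d)) {C : ℝ}
    (hC : ∀ f ∈ (F : Set (Euc d)), ‖f‖ ≤ C) (p q : Sph d) :
    supp F p ≤ supp F q + C * dist p q := by
  have hb : BddAbove ((fun f : Euc d => inner ℝ (q : Euc d) f) '' (F : Set (Euc d))) :=
    (F.isCompact.image (by fun_prop)).bddAbove
  refine csSup_le (F.nonempty.image _) ?_
  rintro _ ⟨f, hf, rfl⟩
  have h1 : inner ℝ (q : Euc d) f ≤ supp F q := le_csSup hb ⟨f, hf, rfl⟩
  have h2 : inner ℝ ((p : Euc d) - (q : Euc d)) f ≤ ‖(p : Euc d) - (q : Euc d)‖ * ‖f‖ :=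
    real_inner_le_norm _ _
  rw [inner_sub_left] at h2
  have h3 : ‖(p : Euc d) - (q : Euc d)‖ * ‖f‖ ≤ C * dist p q := by
    rw [Subtype.dist_eq, dist_eq_norm, mul_comm]
    exact mul_le_mul_of_nonneg_right (hC f hf) (norm_nonneg _)
  change inner ℝ (p : Euc d) f ≤ _
  linarith

theorem continuous_supp {d : ℕ} (F : ConvexBody (Euc d)) : Continuous (supp F) := by
  obtain ⟨C, hC⟩ := F.isCompact.isBounded.exists_norm_le
  obtain ⟨f, hf⟩ := F.nonempty
  have hC0 : 0 ≤ C := (norm_nonneg f).trans (hC f hf)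
  have : LipschitzWith C.toNNReal (supp F) :=
    LipschitzWith.of_le_add_mul _ fun p q => by
      rw [Real.coe_toNNReal C hC0]
      exact supp_le_add F hC p q
  exact this.continuous

theorem memLp_supp {d : ℕ} (F : ConvexBody (Euc d)) : MemLp (supp F) 2 (surf d) := by
  obtain ⟨C, hC⟩ := isCompact_univ.exists_bound_of_continuousOn (continuous_supp F).continuousOn
  exact MemLp.of_bound (continuous_supp F).aestronglyMeasurable C
    (Filter.Eventually.of_forall fun p => hC p (Set.mem_univ p))

/-- The embedding `Ψ(F) = s(·, F)` of the nonempty compact convex sets into `L²`. -/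
def psi {d : ℕ} (F : ConvexBody (Euc d)) : L2Sph d := (memLp_supp F).toLp (supp F)

/-- `F` is a measurable (closed) set valued map: the hitting events of closed sets are
measurable. -/
def IsRandomSet {Ω : Type*} [MeasurableSpace Ω] {d : ℕ} (F : Ω → Set (Euc d)) : Prop :=
  ∀ C : Set (Euc d), IsClosed C → MeasurableSet {ω | (F ω ∩ C).Nonempty}

/-- The Aumann mean: the set of the expectations of all integrable measurable selections. -/
def aumannMean {Ω : Type*} [MeasurableSpace Ω] (P : Measure Ω) {d : ℕ} (F : Ω → Set (Euc d)) :
    Set (Euc d) :=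
  {y | ∃ f : Ω → Euc d, Measurable f ∧ Integrable f P ∧ (∀ᵐ ω ∂P, f ω ∈ F ω) ∧ y = ∫ ω, f ω ∂P}

/-- The covariance matrix `E[(X - E X)(X - E X)']`. -/
def covMat {Ω : Type*} [MeasurableSpace Ω] (P : Measure Ω) {k : ℕ} (X : Ω → Euc k) :
    Matrix (Fin k) (Fin k) ℝ :=
  Matrix.of fun i j => ∫ ω, (X ω i - (∫ η, X η ∂P) i) * (X ω j - (∫ η, X η ∂P) j) ∂P

/-- The weight `w(x, z) = 1 + (x - E X)' Σ⁻¹ (z - E X)`, where `Σ` is the covariance matrix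
of `X`. -/
def weight {Ω : Type*} [MeasurableSpace Ω] (P : Measure Ω) {k : ℕ} (X : Ω → Euc k)
    (x z : Euc k) : ℝ :=
  1 + (x - ∫ η, X η ∂P).ofLp ⬝ᵥ ((covMat P X)⁻¹ *ᵥ (z - ∫ η, X η ∂P).ofLp)

/-- `a` is the unique minimizer of `f` over `S`. -/
def IsUniqueMinimizer {α : Type*} (f : α → ℝ) (S : Set α) (a : α) : Prop :=
  a ∈ S ∧ ∀ b ∈ S, b ≠ a → f a < f b

/-- The weighted mean `E[w(x, X) s(·, F)]`, an expectation in `L²` of the sphere. -/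
def weightedMean {Ω : Type*} [MeasurableSpace Ω] (P : Measure Ω) {d k : ℕ}
    (F : Ω → ConvexBody (Euc d)) (X : Ω → Euc k) (x : Euc k) : L2Sph d :=
  ∫ ω, weight P X x (X ω) • psi (F ω) ∂P

/-- The criterion `ν ↦ E[w(x, X) d_kc(ν, F)²]`. -/
def gfrCriterion {Ω : Type*} [MeasurableSpace Ω] (P : Measure Ω) {d k : ℕ}
    (F : Ω → ConvexBody (Euc d)) (X : Ω → Euc k) (x : Euc k) (ν : ConvexBody (Euc d)) : ℝ :=
  ∫ ω, weight P X x (X ω) * dkc ν (F ω) ^ 2 ∂P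

end FrechetRS

end

/-! The weights have mean one, so expanding the square gives `E[w‖h - Ψ(F)‖²] = ‖h - m‖² + const`
with `m = E[wΨ(F)]`, even where `w` is negative. Minimizing over all of `L²` thus yields `m`, and
minimizing over `Ψ(K_kc^B)` amounts to projecting `m` onto that set. The projection exists and is
unique because the set is convex (`convex_image_psi_KB`) and closed (`isClosed_image_psi_KB`). It
pulls back to a single body by `psi_injective`, and `dkc_sq` turns the distance of sets into the
`L²` distance.

For the inclusion, if `m = Ψ(A)` then `s(p, A) = E[w s(p, F)]` for every `p`, by Fubini and
continuity in `p`. The support function of `wF` is at least `w s(p, F)`; for `w < 0` the inequality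
can be strict, which is why only an inclusion results. Measurable selections of `wF` that nearly
attain this bound are built from nearest points to remote points. A point of `A` outside the Aumann
mean, which is convex and closed (`isClosed_aumannMean`), would be strictly separated from it by a
unit vector, contradicting the bound. -/

noncomputable section

namespace FrechetRS

open Filter Topology

/-! ### Support functions and the image of `psi`. -/

section Support

variable {d : ℕ}

theorem inner_le_supp (F : ConvexBody (Euc d)) (p : Sph d) {f : Euc d}
    (hf : f ∈ (F : Set (Euc d))) : inner ℝ (p : Euc d) f ≤ supp F p :=
  le_csSup (F.isCompact.image (by fun_prop)).bddAbove ⟨f, hf, rfl⟩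

theorem exists_inner_eq_supp (F : ConvexBody (Euc d)) (p : Sph d) :
    ∃ f ∈ (F : Set (Euc d)), inner ℝ (p : Euc d) f = supp F p := by
  have hc : IsCompact ((fun f : Euc d => inner ℝ (p : Euc d) f) '' (F : Set (Euc d))) :=
    F.isCompact.image (by fun_prop)
  obtain ⟨f, hf, h⟩ := hc.sSup_mem (F.nonempty.image _)
  exact ⟨f, hf, h⟩

theorem supp_le_iff (F : ConvexBody (Euc d)) (p : Sph d) (c : ℝ) :
    supp F p ≤ c ↔ ∀ f ∈ (F : Set (Euc d)), inner ℝ (p : Euc d) f ≤ c := by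
  refine ⟨fun h f hf => (inner_le_supp F p hf).trans h, fun h => ?_⟩
  obtain ⟨f, hf, e⟩ := exists_inner_eq_supp F p
  exact e ▸ h f hf

theorem abs_inner_sph_le (p : Sph d) (f : Euc d) : |inner ℝ (p : Euc d) f| ≤ ‖f‖ := by
  simpa using abs_real_inner_le_norm (p : Euc d) f

theorem abs_supp_le {B : ℝ} {F : ConvexBody (Euc d)} (hF : F ∈ KB d B) (p : Sph d) :
    |supp F p| ≤ B := by
  obtain ⟨f, hf, e⟩ := exists_inner_eq_supp F p
  rw [← e]
  exact (abs_inner_sph_le p f).trans (hF f hf)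

theorem supp_combo (F G H : ConvexBody (Euc d)) {a b : ℝ} (ha : 0 ≤ a) (hb : 0 ≤ b)
    (hH : (H : Set (Euc d)) = a • (F : Set (Euc d)) + b • (G : Set (Euc d))) (p : Sph d) :
    supp H p = a * supp F p + b * supp G p := by
  apply le_antisymm
  · rw [supp_le_iff, hH]
    rintro _ ⟨_, ⟨f, hf, rfl⟩, _, ⟨g, hg, rfl⟩, rfl⟩
    simp only [inner_add_right, inner_smul_right]
    exact add_le_add (mul_le_mul_of_nonneg_left (inner_le_supp F p hf) ha)
      (mul_le_mul_of_nonneg_left (inner_le_supp G p hg) hb)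
  · obtain ⟨f, hf, ef⟩ := exists_inner_eq_supp F p
    obtain ⟨g, hg, eg⟩ := exists_inner_eq_supp G p
    have : a • f + b • g ∈ (H : Set (Euc d)) := by
      rw [hH]
      exact Set.add_mem_add (Set.smul_mem_smul_set hf) (Set.smul_mem_smul_set hg)
    have h := inner_le_supp H p this
    rwa [inner_add_right, inner_smul_right, inner_smul_right, ef, eg] at h

/-- A point outside a nonempty closed convex set is strictly separated from it by a unit vector. -/
theorem exists_sph_separating {s : Set (Euc d)} (hs : Convex ℝ s) (hc : IsClosed s)
    (hne : s.Nonempty) {x : Euc d} (hx : x ∉ s) :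
    ∃ (p : Sph d) (u : ℝ), (∀ a ∈ s, inner ℝ (p : Euc d) a ≤ u) ∧ u < inner ℝ (p : Euc d) x := by
  obtain ⟨f, u, h1, h2⟩ := geometric_hahn_banach_closed_point hs hc hx
  set q := (InnerProductSpace.toDual ℝ (Euc d)).symm f with hq
  have hqf (y : Euc d) : inner ℝ q y = f y := InnerProductSpace.toDual_symm_apply
  have hq0 : q ≠ 0 := by
    intro h0
    obtain ⟨a, ha⟩ := hne
    have e1 := hqf a
    have e2 := hqf x
    rw [h0, inner_zero_left] at e1 e2
    have := h1 a ha
    linarith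
  have hpos : 0 < ‖q‖ := norm_pos_iff.2 hq0
  refine ⟨⟨‖q‖⁻¹ • q, by simp [norm_smul, hpos.ne']⟩, ‖q‖⁻¹ * u, fun a ha => ?_, ?_⟩
  · rw [real_inner_smul_left, hqf]
    exact mul_le_mul_of_nonneg_left (h1 a ha).le (by positivity)
  · rw [real_inner_smul_left, hqf]
    exact mul_lt_mul_of_pos_left h2 (by positivity)

theorem subset_of_supp_le {F G : ConvexBody (Euc d)} (h : ∀ p, supp F p ≤ supp G p) :
    (F : Set (Euc d)) ⊆ G := by
  intro x hx
  by_contra hxG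
  obtain ⟨p, u, h1, h2⟩ := exists_sph_separating G.convex G.isClosed G.nonempty hxG
  exact absurd ((supp_le_iff G p u).2 h1)
    (not_le.2 (h2.trans_le ((inner_le_supp F p hx).trans (h p))))

theorem supp_injective : Function.Injective (supp (d := d)) := fun _ _ h =>
  ConvexBody.ext <| (subset_of_supp_le fun p => (congrFun h p).le).antisymm
    (subset_of_supp_le fun p => (congrFun h p).ge)

theorem coeFn_psi (F : ConvexBody (Euc d)) : psi F =ᵐ[surf d] supp F :=
  (memLp_supp F).coeFn_toLp

instance : (surf d).IsOpenPosMeasure := by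
  unfold surf; infer_instance

/-- Surface measure charges every nonempty open set, so almost everywhere equality of continuous
functions is equality. This carries `L²` identities back to every direction `p`. -/
theorem eq_of_ae_eq_supp {F : ConvexBody (Euc d)} {g : Sph d → ℝ} (hg : Continuous g)
    (h : supp F =ᵐ[surf d] g) : supp F = g :=
  Measure.eq_of_ae_eq h (continuous_supp F) hg

theorem psi_injective : Function.Injective (psi (d := d)) := fun _ G h =>
  supp_injective <| eq_of_ae_eq_supp (continuous_supp G) <|
    (coeFn_psi _).symm.trans <| h ▸ coeFn_psi G

theorem norm_sub_psi_sq (h : L2Sph d) (F : ConvexBody (Euc d)) :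
    ‖h - psi F‖ ^ 2 = ∫ p, (h p - supp F p) ^ 2 ∂(surf d) := by
  rw [← real_inner_self_eq_norm_sq, L2.inner_def]
  refine integral_congr_ae ?_
  filter_upwards [Lp.coeFn_sub h (psi F), coeFn_psi F] with p h1 h2
  rw [h1, Pi.sub_apply, h2, real_inner_self_eq_norm_sq, Real.norm_eq_abs, sq_abs]

theorem dkc_sq (F G : ConvexBody (Euc d)) : dkc F G ^ 2 = ‖psi F - psi G‖ ^ 2 := by
  rw [dkc, Real.sq_sqrt (integral_nonneg fun p => sq_nonneg _), norm_sub_psi_sq]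
  refine integral_congr_ae ?_
  filter_upwards [coeFn_psi F] with p h
  rw [h]

theorem convex_image_psi_KB (B : ℝ) : Convex ℝ (psi '' KB d B) := by
  rintro _ ⟨F, hF, rfl⟩ _ ⟨G, hG, rfl⟩ a b ha hb hab
  have hH : ((a • F + b • G : ConvexBody (Euc d)) : Set (Euc d)) =
    a • (F : Set (Euc d)) + b • (G : Set (Euc d)) := rfl
  refine ⟨a • F + b • G, ?_, ?_⟩
  · intro f hf
    rw [hH] at hf
    obtain ⟨_, ⟨f, hf, rfl⟩, _, ⟨g, hg, rfl⟩, rfl⟩ := hf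
    have := (convex_closedBall (0 : Euc d) B) (mem_closedBall_zero_iff.2 (hF f hf))
      (mem_closedBall_zero_iff.2 (hG g hg)) ha hb hab
    exact mem_closedBall_zero_iff.1 this
  · apply Lp.ext
    filter_upwards [coeFn_psi (a • F + b • G), coeFn_psi F, coeFn_psi G,
      Lp.coeFn_add (a • psi F) (b • psi G), Lp.coeFn_smul a (psi F),
      Lp.coeFn_smul b (psi G)] with p h1 h2 h3 h4 h5 h6
    rw [h1, h4, Pi.add_apply, h5, h6, Pi.smul_apply, Pi.smul_apply, h2, h3,
      supp_combo F G _ ha hb hH]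
    rfl

/-- Uniformly bounded convex bodies whose support functions converge almost everywhere have a
limiting convex body, obtained from the limits of their selections along an ultrafilter. -/
theorem exists_supp_ae_eq_of_tendsto {B : ℝ} {F : ℕ → ConvexBody (Euc d)}
    (hF : ∀ n, F n ∈ KB d B) {g : Sph d → ℝ}
    (hg : ∀ᵐ p ∂(surf d), Tendsto (fun n => supp (F n) p) atTop (𝓝 (g p))) :
    ∃ M ∈ KB d B, supp M =ᵐ[surf d] g := by
  -- Along an ultrafilter every bounded selection converges without passing to a subsequence. The
  -- limits of two selections can therefore be combined, which makes `S` convex.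
  set U : Ultrafilter ℕ := hyperfilter ℕ
  have hU : (U : Filter ℕ) ≤ atTop := Nat.hyperfilter_le_atTop
  set S : Set (Euc d) := {y | ∃ f : ℕ → Euc d, (∀ n, f n ∈ (F n : Set (Euc d))) ∧
    Tendsto f U (𝓝 y)} with hS
  have hSB : S ⊆ Metric.closedBall 0 B := by
    rintro y ⟨f, hf, hy⟩
    exact Metric.isClosed_closedBall.mem_of_tendsto hy
      (Eventually.of_forall fun n => mem_closedBall_zero_iff.2 (hF n _ (hf n)))
  have hlim (f : ℕ → Euc d) (hf : ∀ n, f n ∈ (F n : Set (Euc d))) :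
      ∃ y ∈ S, Tendsto f U (𝓝 y) := by
    obtain ⟨y, -, hy⟩ := (isCompact_closedBall (0 : Euc d) B).ultrafilter_le_nhds (U.map f)
      (tendsto_principal.2 (Eventually.of_forall fun n => mem_closedBall_zero_iff.2 (hF n _ (hf n))))
    exact ⟨y, ⟨f, hf, hy⟩, hy⟩
  have hSne : S.Nonempty := by
    choose f hf using fun n => (F n).nonempty
    obtain ⟨y, hy, -⟩ := hlim f hf
    exact ⟨y, hy⟩
  have hSconv : Convex ℝ S := by
    rintro y ⟨f, hf, hy⟩ z ⟨e, he, hz⟩ a b ha hb hab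
    exact ⟨fun n => a • f n + b • e n, fun n => (F n).convex (hf n) (he n) ha hb hab,
      (hy.const_smul a).add (hz.const_smul b)⟩
  have hcl : closure S ⊆ Metric.closedBall 0 B := closure_minimal hSB Metric.isClosed_closedBall
  refine ⟨⟨closure S, hSconv.closure,
    (isCompact_closedBall (0 : Euc d) B).of_isClosed_subset isClosed_closure hcl,
    hSne.closure⟩, fun f hf => mem_closedBall_zero_iff.1 (hcl hf), ?_⟩
  filter_upwards [hg] with p hp
  have hp' := hp.mono_left hU
  apply le_antisymm
  · rw [supp_le_iff]
    have hclosed : IsClosed {f : Euc d | inner ℝ (p : Euc d) f ≤ g p} :=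
      isClosed_le (by fun_prop) continuous_const
    refine fun f hf => closure_minimal ?_ hclosed hf
    rintro y ⟨f, hf, hy⟩
    exact le_of_tendsto_of_tendsto' (tendsto_const_nhds.inner hy) hp'
      fun n => inner_le_supp (F n) p (hf n)
  -- Maximizers of `⟨p, ·⟩` in the `F n` have a limit in `S`, and it attains `g p`.
  · choose f hf hfe using fun n => exists_inner_eq_supp (F n) p
    obtain ⟨y, hyS, hy⟩ := hlim f hf
    have h1 : Tendsto (fun n => supp (F n) p) U (𝓝 (inner ℝ (p : Euc d) y)) := by
      simp_rw [← hfe]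
      exact tendsto_const_nhds.inner hy
    rw [tendsto_nhds_unique hp' h1]
    exact inner_le_supp _ p (subset_closure hyS)

/-- An `L²` convergent sequence has an almost everywhere convergent subsequence, whose limit is
again a support function. -/
theorem isClosed_image_psi_KB (B : ℝ) : IsClosed (psi '' KB d B) := by
  refine IsSeqClosed.isClosed fun u h hu hlim => ?_
  choose F hF hFu using hu
  obtain ⟨ns, -, hns⟩ := (tendstoInMeasure_of_tendsto_Lp hlim).exists_seq_tendsto_ae
  have : ∀ᵐ p ∂(surf d), Tendsto (fun n => supp (F (ns n)) p) atTop (𝓝 (h p)) := by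
    filter_upwards [hns, ae_all_iff.2 fun n => coeFn_psi (F n)] with p h1 h2
    simpa only [← hFu, h2] using h1
  obtain ⟨M, hM, e⟩ := exists_supp_ae_eq_of_tendsto (fun n => hF (ns n)) this
  exact ⟨M, hM, Lp.ext ((coeFn_psi M).trans e)⟩

end Support

/-! ### Nearest points in convex bodies. -/

section Nearest

variable {d : ℕ}

theorem exists_nearest (F : ConvexBody (Euc d)) (q : Euc d) :
    ∃ y ∈ (F : Set (Euc d)), ∀ z ∈ (F : Set (Euc d)), inner ℝ (q - y) (z - y) ≤ 0 := by
  obtain ⟨y, hy, h⟩ := exists_norm_eq_iInf_of_complete_convex F.nonempty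
    F.isClosed.isComplete F.convex q
  exact ⟨y, hy, (norm_eq_iInf_iff_real_inner_le_zero F.convex hy).1 h⟩

/-- The nearest point to `q` in the convex body `F`. -/
def nearest (F : ConvexBody (Euc d)) (q : Euc d) : Euc d := (exists_nearest F q).choose

theorem nearest_mem (F : ConvexBody (Euc d)) (q : Euc d) : nearest F q ∈ (F : Set (Euc d)) :=
  (exists_nearest F q).choose_spec.1

/-- The angle at the projection is not acute. The extra square on the left gives uniqueness as well
as minimality. -/
theorem norm_sub_nearest_sq_add_le (F : ConvexBody (Euc d)) (q : Euc d) {z : Euc d}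
    (hz : z ∈ (F : Set (Euc d))) :
    ‖q - nearest F q‖ ^ 2 + ‖z - nearest F q‖ ^ 2 ≤ ‖q - z‖ ^ 2 := by
  have h := (exists_nearest F q).choose_spec.2 z hz
  change inner ℝ (q - nearest F q) (z - nearest F q) ≤ 0 at h
  have e := norm_sub_sq_real (q - nearest F q) (z - nearest F q)
  rw [sub_sub_sub_cancel_right] at e
  linarith

theorem norm_sub_nearest_le (F : ConvexBody (Euc d)) (q : Euc d) {z : Euc d}
    (hz : z ∈ (F : Set (Euc d))) : ‖q - nearest F q‖ ≤ ‖q - z‖ := by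
  refine (pow_le_pow_iff_left₀ (norm_nonneg _) (norm_nonneg _) two_ne_zero).1 ?_
  linarith [norm_sub_nearest_sq_add_le F q hz, sq_nonneg ‖z - nearest F q‖]

theorem eq_nearest_of_norm_le (F : ConvexBody (Euc d)) (q : Euc d) {z : Euc d}
    (hz : z ∈ (F : Set (Euc d))) (h : ‖q - z‖ ≤ ‖q - nearest F q‖) : z = nearest F q := by
  have h1 := norm_sub_nearest_sq_add_le F q hz
  have h2 : ‖q - z‖ ^ 2 ≤ ‖q - nearest F q‖ ^ 2 := by gcongr
  have h3 : ‖z - nearest F q‖ ^ 2 = 0 := le_antisymm (by linarith) (sq_nonneg _)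
  exact sub_eq_zero.1 (norm_eq_zero.1 (pow_eq_zero_iff two_ne_zero |>.1 h3))

/-- The nearest point to a remote point in direction `p` almost maximizes `⟨p, ·⟩`. -/
theorem supp_sub_le_inner_nearest {B : ℝ} {F : ConvexBody (Euc d)} (hF : F ∈ KB d B) (p : Sph d)
    {t : ℝ} (ht : 0 < t) :
    supp F p - B ^ 2 / (2 * t) ≤ inner ℝ (p : Euc d) (nearest F (t • (p : Euc d))) := by
  obtain ⟨f, hf, e⟩ := exists_inner_eq_supp F p
  set y := nearest F (t • (p : Euc d)) with hy
  have h : ‖t • (p : Euc d) - y‖ ^ 2 ≤ ‖t • (p : Euc d) - f‖ ^ 2 := by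
    gcongr
    exact norm_sub_nearest_le F _ hf
  -- The terms `‖t • p‖²` cancel, leaving `2t(s(p, F) - ⟨p, y⟩) ≤ ‖f‖² - ‖y‖² ≤ B²`.
  rw [norm_sub_sq_real, norm_sub_sq_real, real_inner_smul_left, real_inner_smul_left, e] at h
  have hfB : ‖f‖ ^ 2 ≤ B ^ 2 := by
    gcongr
    exact hF f hf
  rw [sub_le_iff_le_add, ← sub_le_iff_le_add', le_div_iff₀ (by positivity)]
  nlinarith [sq_nonneg ‖y‖]

end Nearest

/-! ### Measurability, integrability and the pointwise form of the weighted mean. -/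

section Measurability

variable {d : ℕ} {Ω : Type*} [MeasurableSpace Ω] {F : Ω → ConvexBody (Euc d)}

/-- The nearest point lies in `C` exactly when every rational ball around `q` that hits `F ω` also
hits `F ω ∩ C`. This is a countable condition on hitting events of closed sets. -/
theorem measurable_nearest (hF : IsRandomSet fun ω => (F ω : Set (Euc d))) (q : Euc d) :
    Measurable fun ω => nearest (F ω) q := by
  refine measurable_of_isClosed fun C hC => ?_
  have key : (fun ω => nearest (F ω) q) ⁻¹' C = ⋂ r : ℚ,
      {ω | ((F ω : Set (Euc d)) ∩ Metric.closedBall q r).Nonempty}ᶜ ∪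
      {ω | ((F ω : Set (Euc d)) ∩ (C ∩ Metric.closedBall q r)).Nonempty} := by
    ext ω
    simp only [Set.mem_preimage, Set.mem_iInter, Set.mem_union, Set.mem_compl_iff,
      Set.mem_ofPred_eq, ← imp_iff_not_or]
    constructor
    · rintro h r ⟨z, hz, hzr⟩
      refine ⟨_, nearest_mem _ q, h, ?_⟩
      rw [mem_closedBall_iff_norm'] at hzr ⊢
      exact (norm_sub_nearest_le _ q hz).trans hzr
    · intro h
      have hr (r : ℚ) (hr : ‖q - nearest (F ω) q‖ < r) :
          ((F ω : Set (Euc d)) ∩ (C ∩ Metric.closedBall q r)).Nonempty :=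
        h r ⟨_, nearest_mem _ q, mem_closedBall_iff_norm'.2 hr.le⟩
      have hne : ((F ω : Set (Euc d)) ∩ C).Nonempty := by
        obtain ⟨r, h1⟩ := exists_rat_gt ‖q - nearest (F ω) q‖
        obtain ⟨z, hz, hzC, -⟩ := hr r h1
        exact ⟨z, hz, hzC⟩
      obtain ⟨z, hz, hzmin⟩ := ((F ω).isCompact.inter_right hC).exists_isMinOn hne
        (f := fun z => ‖q - z‖) (by fun_prop)
      -- Otherwise a rational radius strictly between the two distances gives a point of `F ω ∩ C`
      -- closer to `q` than the minimizer `z`.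
      have hle : ‖q - z‖ ≤ ‖q - nearest (F ω) q‖ := by
        by_contra! hlt
        obtain ⟨r, h1, h2⟩ := exists_rat_btwn hlt
        obtain ⟨y, hy, hyC, hyr⟩ := hr r h1
        rw [mem_closedBall_iff_norm'] at hyr
        have : ‖q - z‖ ≤ ‖q - y‖ := hzmin ⟨hy, hyC⟩
        linarith
      exact eq_nearest_of_norm_le _ q hz.1 hle ▸ hz.2
  rw [key]
  exact MeasurableSet.iInter fun r => (hF _ Metric.isClosed_closedBall).compl.union
    (hF _ (hC.inter Metric.isClosed_closedBall))

theorem measurable_supp (hF : IsRandomSet fun ω => (F ω : Set (Euc d))) (p : Sph d) :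
    Measurable fun ω => supp (F ω) p := by
  refine measurable_of_Ici fun c => ?_
  have key : (fun ω => supp (F ω) p) ⁻¹' Set.Ici c =
      {ω | ((F ω : Set (Euc d)) ∩ {f | c ≤ inner ℝ (p : Euc d) f}).Nonempty} := by
    ext ω
    constructor
    · intro h
      obtain ⟨f, hf, e⟩ := exists_inner_eq_supp (F ω) p
      exact ⟨f, hf, le_of_le_of_eq h e.symm⟩
    · rintro ⟨f, hf, h⟩
      exact le_trans h (inner_le_supp _ p hf)
  rw [key]
  exact hF _ (isClosed_le continuous_const (by fun_prop))

theorem measurable_uncurry_supp (hF : IsRandomSet fun ω => (F ω : Set (Euc d))) :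
    Measurable (Function.uncurry fun ω p => supp (F ω) p) := by
  have swap (u : Ω → Sph d → ℝ) (hc : ∀ ω, Continuous (u ω)) (hm : ∀ p, Measurable fun ω => u ω p) :
      Measurable (Function.uncurry u) :=
    (measurable_uncurry_of_continuous_of_measurable (u := fun p ω => u ω p) hc hm).comp
      measurable_swap
  exact swap _ (fun ω => continuous_supp (F ω)) (measurable_supp hF)

/-- A map into a separable metric space is measurable if its distances to all points are. -/
theorem measurable_of_dist {E : Type*} [PseudoMetricSpace E] [SecondCountableTopology E]
    [MeasurableSpace E] [BorelSpace E] {f : Ω → E} (h : ∀ c, Measurable fun ω => dist (f ω) c) :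
    Measurable f := by
  refine measurable_of_isOpen fun U hU => ?_
  choose! r hr0 hr using Metric.isOpen_iff.1 hU
  obtain ⟨T, hT, hTU⟩ := TopologicalSpace.isOpen_iUnion_countable
    (fun x : U => Metric.ball (x : E) (r x)) fun _ => Metric.isOpen_ball
  have hUT : U = ⋃ x ∈ T, Metric.ball (x : E) (r x) := by
    rw [hTU]
    refine Set.Subset.antisymm (fun x hx => Set.mem_iUnion.2 ⟨⟨x, hx⟩, ?_⟩)
      (Set.iUnion_subset fun x => hr x x.2)
    exact Metric.mem_ball_self (hr0 x hx)
  rw [hUT, Set.preimage_iUnion₂]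
  exact MeasurableSet.biUnion hT fun x _ => measurableSet_lt (h x) measurable_const

/-- As `L²` is separable, it suffices that distances to fixed elements are measurable, and these are
parametric integrals of a jointly measurable function. -/
theorem stronglyMeasurable_psi (hF : IsRandomSet fun ω => (F ω : Set (Euc d))) :
    StronglyMeasurable fun ω => psi (F ω) := by
  borelize (L2Sph d)
  have : Fact ((2 : ENNReal) ≠ ⊤) := ⟨ENNReal.ofNat_ne_top⟩
  have : SecondCountableTopology (L2Sph d) := Lp.SecondCountableTopology
  refine Measurable.stronglyMeasurable (measurable_of_dist fun h => ?_)
  have e : (fun ω => dist (psi (F ω)) h) =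
      fun ω => √(∫ p, (h p - supp (F ω) p) ^ 2 ∂(surf d)) := by
    ext ω
    rw [← norm_sub_psi_sq, Real.sqrt_sq (norm_nonneg _), dist_comm, dist_eq_norm]
  rw [e]
  refine Measurable.sqrt (StronglyMeasurable.measurable ?_)
  refine StronglyMeasurable.integral_prod_right (f := fun ω p => (h p - supp (F ω) p) ^ 2) ?_
  refine Measurable.stronglyMeasurable ?_
  exact (((Lp.stronglyMeasurable h).measurable.comp measurable_snd).sub
    (measurable_uncurry_supp hF)).pow_const 2

theorem norm_psi_le {B : ℝ} {F : ConvexBody (Euc d)} (hF : F ∈ KB d B) :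
    ‖psi F‖ ≤ √(B ^ 2 * (surf d).real Set.univ) := by
  have h := norm_sub_psi_sq 0 F
  rw [zero_sub, norm_neg] at h
  refine Real.le_sqrt_of_sq_le (h.trans_le ?_)
  have : ∀ᵐ p ∂(surf d), ((0 : L2Sph d) p - supp F p) ^ 2 ≤ B ^ 2 := by
    filter_upwards [Lp.coeFn_zero ℝ 2 (surf d)] with p hp
    rw [hp, Pi.zero_apply, zero_sub, neg_sq]
    exact sq_le_sq' (neg_le_of_abs_le (abs_supp_le hF p)) (le_of_abs_le (abs_supp_le hF p))
  calc _ ≤ ∫ _, B ^ 2 ∂(surf d) := by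
        refine integral_mono_of_nonneg (Eventually.of_forall fun _ => sq_nonneg _)
          (integrable_const _) this
    _ = _ := by rw [integral_const, smul_eq_mul, mul_comm]

variable {P : Measure Ω} {B : ℝ} {w : Ω → ℝ}

theorem integrable_smul_psi (hF : IsRandomSet fun ω => (F ω : Set (Euc d)))
    (hFB : ∀ ω, F ω ∈ KB d B) (hw : Integrable w P) :
    Integrable (fun ω => w ω • psi (F ω)) P :=
  hw.smul_bdd _ (stronglyMeasurable_psi hF).aestronglyMeasurable
    (Eventually.of_forall fun ω => norm_psi_le (hFB ω))

theorem integrable_mul_supp (hF : IsRandomSet fun ω => (F ω : Set (Euc d)))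
    (hFB : ∀ ω, F ω ∈ KB d B) (hw : Integrable w P) (p : Sph d) :
    Integrable (fun ω => w ω * supp (F ω) p) P :=
  hw.mul_bdd (measurable_supp hF p).aestronglyMeasurable
    (Eventually.of_forall fun ω => abs_supp_le (hFB ω) p)

theorem integrable_mul_norm_sub_psi_sq (hF : IsRandomSet fun ω => (F ω : Set (Euc d)))
    (hFB : ∀ ω, F ω ∈ KB d B) (hw : Integrable w P) (h : L2Sph d) :
    Integrable (fun ω => w ω * ‖h - psi (F ω)‖ ^ 2) P := by
  refine hw.mul_bdd (c := (‖h‖ + √(B ^ 2 * (surf d).real Set.univ)) ^ 2)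
    ((stronglyMeasurable_const.sub (stronglyMeasurable_psi hF)).norm.pow 2).aestronglyMeasurable
    (Eventually.of_forall fun ω => ?_)
  rw [Real.norm_of_nonneg (sq_nonneg _)]
  gcongr
  exact (norm_sub_le _ _).trans (by gcongr; exact norm_psi_le (hFB ω))

theorem continuous_integral_mul_supp (hF : IsRandomSet fun ω => (F ω : Set (Euc d)))
    (hFB : ∀ ω, F ω ∈ KB d B) (hw : Integrable w P) :
    Continuous fun p : Sph d => ∫ ω, w ω * supp (F ω) p ∂P := by
  refine continuous_of_dominated (bound := fun ω => |w ω| * B)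
    (fun p => (integrable_mul_supp hF hFB hw p).aestronglyMeasurable)
    (fun p => Eventually.of_forall fun ω => ?_) (hw.abs.mul_const B)
    (Eventually.of_forall fun ω => continuous_const.mul (continuous_supp (F ω)))
  rw [norm_mul]
  exact mul_le_mul_of_nonneg_left (abs_supp_le (hFB ω) p) (abs_nonneg _)

/-- The weighted `L²` mean of the support functions is the pointwise weighted mean. -/
theorem integral_smul_psi_ae_eq [SFinite P] (hF : IsRandomSet fun ω => (F ω : Set (Euc d)))
    (hFB : ∀ ω, F ω ∈ KB d B) (hw : Integrable w P) :
    (∫ ω, w ω • psi (F ω) ∂P : L2Sph d) =ᵐ[surf d] fun p => ∫ ω, w ω * supp (F ω) p ∂P := by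
  have hgc := continuous_integral_mul_supp hF hFB hw
  obtain ⟨C, hC⟩ := isCompact_univ.exists_bound_of_continuousOn hgc.continuousOn
  have hg : MemLp (fun p => ∫ ω, w ω * supp (F ω) p ∂P) 2 (surf d) :=
    MemLp.of_bound hgc.aestronglyMeasurable C (Eventually.of_forall fun p => hC p (Set.mem_univ p))
  suffices h : ∫ ω, w ω • psi (F ω) ∂P = hg.toLp _ by
    rw [h]
    exact hg.coeFn_toLp
  -- Testing against an arbitrary `v` turns the claim into an exchange of integrals.
  refine ext_inner_left ℝ fun v => ?_
  have hv : Integrable (v : Sph d → ℝ) (surf d) :=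
    (Lp.memLp v).integrable (by norm_num)
  have hint : Integrable (Function.uncurry fun ω p => v p * (w ω * supp (F ω) p))
      (P.prod (surf d)) := by
    have h1 : Integrable (fun z : Ω × Sph d => w z.1 * v z.2) (P.prod (surf d)) := hw.mul_prod hv
    refine (h1.mul_bdd (measurable_uncurry_supp hF).aestronglyMeasurable
      (Eventually.of_forall fun z => abs_supp_le (hFB z.1) z.2)).congr
      (Eventually.of_forall fun z => ?_)
    simp only [Function.uncurry]
    ring
  calc inner ℝ v (∫ ω, w ω • psi (F ω) ∂P)
      = ∫ ω, inner ℝ v (w ω • psi (F ω)) ∂P :=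
        (integral_inner (integrable_smul_psi hF hFB hw) v).symm
    _ = ∫ ω, ∫ p, v p * (w ω * supp (F ω) p) ∂(surf d) ∂P := by
        refine integral_congr_ae (Eventually.of_forall fun ω => ?_)
        simp only
        rw [L2.inner_def]
        refine integral_congr_ae ?_
        filter_upwards [Lp.coeFn_smul (w ω) (psi (F ω)), coeFn_psi (F ω)] with p h1 h2
        rw [h1, Pi.smul_apply, h2, smul_eq_mul, real_inner_comm]
        rfl
    _ = ∫ p, v p * ∫ ω, w ω * supp (F ω) p ∂P ∂(surf d) := by
        rw [integral_integral_swap hint]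
        exact integral_congr_ae (Eventually.of_forall fun p => integral_const_mul _ _)
    _ = inner ℝ v (hg.toLp _) := by
        rw [L2.inner_def]
        refine integral_congr_ae ?_
        filter_upwards [hg.coeFn_toLp] with p h1
        rw [h1, real_inner_comm]
        rfl

end Measurability

/-! ### Convexity and closedness of the Aumann mean. -/

section AumannMean

/-- A decreasing sequence of nonempty bounded closed convex subsets of a Hilbert space has a
common point. -/
theorem nonempty_iInter_of_antitone_convex {H : Type*} [NormedAddCommGroup H]
    [InnerProductSpace ℝ H] [CompleteSpace H] {S : ℕ → Set H} (hanti : Antitone S)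
    (hconv : ∀ n, Convex ℝ (S n)) (hcl : ∀ n, IsClosed (S n)) (hne : ∀ n, (S n).Nonempty)
    {C : ℝ} (hC : ∀ f ∈ S 0, ‖f‖ ≤ C) : (⋂ n, S n).Nonempty := by
  have hex (n : ℕ) : ∃ v ∈ S n, ∀ u ∈ S n, inner ℝ (0 - v) (u - v) ≤ 0 := by
    obtain ⟨v, hv, h⟩ := exists_norm_eq_iInf_of_complete_convex (hne n) (hcl n).isComplete
      (hconv n) 0
    exact ⟨v, hv, (norm_eq_iInf_iff_real_inner_le_zero (hconv n) hv).1 h⟩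
  -- The elements of least norm form a Cauchy sequence: their squared norms increase, are bounded,
  -- and control the mutual distances through the variational inequality.
  choose v hv hmin using hex
  have hsq {n m : ℕ} (h : n ≤ m) : ‖v m - v n‖ ^ 2 ≤ ‖v m‖ ^ 2 - ‖v n‖ ^ 2 := by
    have h1 := hmin n (v m) (hanti h (hv m))
    rw [zero_sub, inner_neg_left, inner_sub_right, real_inner_self_eq_norm_sq] at h1
    have h2 := norm_sub_sq_real (v m) (v n)
    rw [real_inner_comm] at h2
    linarith
  have hmono : Monotone fun n => ‖v n‖ ^ 2 := fun n m h => by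
    have := (sq_nonneg _).trans (hsq h)
    simpa using this
  have hbdd : BddAbove (Set.range fun n => ‖v n‖ ^ 2) := by
    refine ⟨C ^ 2, ?_⟩
    rintro _ ⟨n, rfl⟩
    exact pow_le_pow_left₀ (norm_nonneg _) (hC _ (hanti (Nat.zero_le n) (hv n))) 2
  set L := ⨆ n, ‖v n‖ ^ 2 with hL
  have hlim : Tendsto (fun n => ‖v n‖ ^ 2) atTop (𝓝 L) := tendsto_atTop_ciSup hmono hbdd
  have hdist {n m : ℕ} (h : n ≤ m) : dist (v m) (v n) ≤ √(L - ‖v n‖ ^ 2) := by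
    rw [dist_eq_norm]
    refine Real.le_sqrt_of_sq_le ((hsq h).trans ?_)
    have := le_ciSup hbdd m
    linarith
  have hcauchy : CauchySeq v := by
    refine cauchySeq_of_le_tendsto_0' (fun n => √(L - ‖v n‖ ^ 2))
      (fun n m h => by rw [dist_comm]; exact hdist h) ?_
    have := (tendsto_const_nhds (x := L)).sub hlim
    rw [sub_self] at this
    simpa using this.sqrt
  obtain ⟨y, hy⟩ := cauchySeq_tendsto_of_complete hcauchy
  refine ⟨y, Set.mem_iInter.2 fun n => (hcl n).mem_of_tendsto hy ?_⟩
  filter_upwards [eventually_ge_atTop n] with m hm using hanti hm (hv m)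

variable {Ω : Type*} [MeasurableSpace Ω] {P : Measure Ω} {d : ℕ} {F : Ω → Set (Euc d)}

theorem convex_aumannMean (hconv : ∀ ω, Convex ℝ (F ω)) : Convex ℝ (aumannMean P F) := by
  rintro _ ⟨f, hfm, hfi, hf, rfl⟩ _ ⟨g, hgm, hgi, hg, rfl⟩ a b ha hb hab
  refine ⟨fun ω => a • f ω + b • g ω, (hfm.const_smul a).add (hgm.const_smul b),
    (hfi.smul a).add (hgi.smul b), ?_, ?_⟩
  · filter_upwards [hf, hg] with ω h1 h2 using hconv ω h1 h2 ha hb hab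
  · rw [← integral_smul, ← integral_smul]
    exact (integral_add (hfi.smul a) (hgi.smul b)).symm

theorem norm_integral_Lp_two_le [IsProbabilityMeasure P] (f : Lp (Euc d) 2 P) :
    ‖∫ ω, f ω ∂P‖ ≤ ‖f‖ := by
  rw [Lp.norm_def, ← toReal_enorm]
  refine ENNReal.toReal_mono (Lp.eLpNorm_ne_top f) ?_
  calc ‖∫ ω, f ω ∂P‖ₑ ≤ ∫⁻ ω, ‖f ω‖ₑ ∂P := enorm_integral_le_lintegral_enorm _
    _ = eLpNorm f 1 P := eLpNorm_one_eq_lintegral_enorm.symm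
    _ ≤ eLpNorm f 2 P := eLpNorm_le_eLpNorm_of_exponent_le (by norm_num) (Lp.aestronglyMeasurable f)

/-- The expectation on square integrable random vectors. -/
def expectationL2 (P : Measure Ω) [IsProbabilityMeasure P] (d : ℕ) : Lp (Euc d) 2 P →L[ℝ] Euc d :=
  LinearMap.mkContinuous
    { toFun := fun f => ∫ ω, f ω ∂P
      map_add' := fun f g => by
        rw [← integral_add ((Lp.memLp f).integrable (by norm_num))
          ((Lp.memLp g).integrable (by norm_num))]
        exact integral_congr_ae (Lp.coeFn_add f g)
      map_smul' := fun c f => by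
        rw [RingHom.id_apply, ← integral_smul]
        exact integral_congr_ae (Lp.coeFn_smul c f) }
    1 fun f => by simpa using norm_integral_Lp_two_le f

theorem expectationL2_apply [IsProbabilityMeasure P] (f : Lp (Euc d) 2 P) :
    expectationL2 P d f = ∫ ω, f ω ∂P := rfl

/-- The Aumann mean of a square integrably bounded closed convex valued map is closed. -/
theorem isClosed_aumannMean [IsProbabilityMeasure P] (hconv : ∀ ω, Convex ℝ (F ω))
    (hcl : ∀ ω, IsClosed (F ω)) {g : Ω → ℝ} (hg : MemLp g 2 P)
    (hFg : ∀ ω, ∀ f ∈ F ω, ‖f‖ ≤ g ω) : IsClosed (aumannMean P F) := by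
  set S : Set (Lp (Euc d) 2 P) := {f | ∀ᵐ ω ∂P, f ω ∈ F ω} with hS
  have hSconv : Convex ℝ S := by
    intro f hf h hh a b ha hb hab
    filter_upwards [hf, hh, Lp.coeFn_add (a • f) (b • h), Lp.coeFn_smul a f,
      Lp.coeFn_smul b h] with ω h1 h2 h3 h4 h5
    rw [h3, Pi.add_apply, h4, h5]
    exact hconv ω h1 h2 ha hb hab
  have hScl : IsClosed S := by
    refine IsSeqClosed.isClosed fun u f hu hlim => ?_
    obtain ⟨ns, -, hns⟩ := (tendstoInMeasure_of_tendsto_Lp hlim).exists_seq_tendsto_ae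
    filter_upwards [hns, ae_all_iff.2 hu] with ω h1 h2
    exact (hcl ω).mem_of_tendsto h1 (Eventually.of_forall fun n => h2 (ns n))
  have hSbd : ∀ f ∈ S, ‖f‖ ≤ ‖hg.toLp g‖ := by
    intro f hf
    refine Lp.norm_le_norm_of_ae_le ?_
    filter_upwards [hf, hg.coeFn_toLp] with ω h1 h2
    rw [h2]
    exact (hFg ω _ h1).trans (le_abs_self _)
  -- The bound `g` makes every selection square integrable, so the Hilbert space `L²` suffices to
  -- describe all of them.
  have himage : aumannMean P F = expectationL2 P d '' S := by
    ext y
    constructor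
    · rintro ⟨f, hfm, -, hf, rfl⟩
      have hf2 : MemLp f 2 P := hg.mono hfm.aestronglyMeasurable (by
        filter_upwards [hf] with ω h1 using (hFg ω _ h1).trans (le_abs_self _))
      refine ⟨hf2.toLp f, ?_, ?_⟩
      · filter_upwards [hf, hf2.coeFn_toLp] with ω h1 h2
        rwa [h2]
      · rw [expectationL2_apply]
        exact integral_congr_ae hf2.coeFn_toLp
    · rintro ⟨f, hf, rfl⟩
      exact ⟨f, (Lp.stronglyMeasurable f).measurable, (Lp.memLp f).integrable (by norm_num),
        hf, rfl⟩
  rw [himage]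
  refine isClosed_of_closure_subset fun y hy => ?_
  have hT := (expectationL2 P d).continuous
  -- The selections with expectation within `1 / (n + 1)` of `y` decrease with `n`; a common element
  -- has expectation exactly `y`. This plays the role of weak compactness.
  obtain ⟨f, hf⟩ := nonempty_iInter_of_antitone_convex
    (S := fun n : ℕ => S ∩ expectationL2 P d ⁻¹' Metric.closedBall y (1 / (n + 1)))
    (fun n m h => Set.inter_subset_inter_right _ (Set.preimage_mono
      (Metric.closedBall_subset_closedBall (Nat.one_div_le_one_div h))))
    (fun n => hSconv.inter ((convex_closedBall _ _).linear_preimage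
      (expectationL2 P d : Lp (Euc d) 2 P →ₗ[ℝ] Euc d)))
    (fun n => hScl.inter (Metric.isClosed_closedBall.preimage hT))
    (fun n => by
      obtain ⟨_, ⟨f, hf, rfl⟩, h⟩ := Metric.mem_closure_iff.1 hy (1 / (n + 1)) (by positivity)
      exact ⟨f, hf, by rw [Set.mem_preimage, Metric.mem_closedBall, dist_comm]; exact h.le⟩)
    (fun f hf => hSbd f hf.1)
  rw [Set.mem_iInter] at hf
  refine ⟨f, (hf 0).1, dist_le_zero.1 ?_⟩
  exact ge_of_tendsto' tendsto_one_div_add_atTop_nhds_zero_nat fun n => (hf n).2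

end AumannMean

/-! ### Nearly optimal selections and the inclusion in the Aumann mean. -/

section Inclusion

variable {Ω : Type*} {d : ℕ} {F : Ω → ConvexBody (Euc d)} {B : ℝ} {w : Ω → ℝ}

/-- The selection of `w • F` whose inner product with `p` is close to maximal. -/
def selection (F : Ω → ConvexBody (Euc d)) (w : Ω → ℝ) (p : Sph d) (t : ℝ) (ω : Ω) : Euc d :=
  if 0 ≤ w ω then w ω • nearest (F ω) (t • (p : Euc d))
  -- For a negative weight, maximizing `⟨p, w f⟩` means maximizing `⟨-p, f⟩`.
  else w ω • nearest (F ω) (t • ((-p : Sph d) : Euc d))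

theorem selection_mem (p : Sph d) (t : ℝ) (ω : Ω) :
    selection F w p t ω ∈ w ω • (F ω : Set (Euc d)) := by
  unfold selection
  split_ifs
  · exact Set.smul_mem_smul_set (nearest_mem _ _)
  · exact Set.smul_mem_smul_set (nearest_mem _ _)

theorem norm_le_of_mem_smul (hFB : ∀ ω, F ω ∈ KB d B) (ω : Ω) :
    ∀ f ∈ w ω • (F ω : Set (Euc d)), ‖f‖ ≤ |w ω| * B := by
  rintro _ ⟨f, hf, rfl⟩
  rw [norm_smul, Real.norm_eq_abs]
  exact mul_le_mul_of_nonneg_left (hFB ω f hf) (abs_nonneg _)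

theorem le_inner_selection (hFB : ∀ ω, F ω ∈ KB d B) (p : Sph d) {t : ℝ} (ht : 0 < t) (ω : Ω) :
    w ω * supp (F ω) p - |w ω| * (B ^ 2 / (2 * t)) ≤ inner ℝ (p : Euc d) (selection F w p t ω) := by
  unfold selection
  split_ifs with h
  · rw [inner_smul_right, abs_of_nonneg h, ← mul_sub]
    exact mul_le_mul_of_nonneg_left (supp_sub_le_inner_nearest (hFB ω) p ht) h
  · have hw : 0 ≤ -w ω := by linarith
    have h1 := supp_sub_le_inner_nearest (hFB ω) (-p) ht
    -- The width `s(p, F) + s(-p, F)` is nonnegative; this is where equality is lost for negative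
    -- weights.
    have h2 : -supp (F ω) p ≤ supp (F ω) (-p) := by
      obtain ⟨f, hf⟩ := (F ω).nonempty
      have e1 := inner_le_supp (F ω) p hf
      have e2 := inner_le_supp (F ω) (-p) hf
      rw [coe_neg_sphere, inner_neg_left] at e2
      linarith
    set y := nearest (F ω) (t • ((-p : Sph d) : Euc d))
    rw [coe_neg_sphere, inner_neg_left] at h1
    rw [inner_smul_right, abs_of_neg (not_le.1 h)]
    nlinarith

variable [MeasurableSpace Ω] {P : Measure Ω}

theorem measurable_selection (hF : IsRandomSet fun ω => (F ω : Set (Euc d))) (hw : Measurable w)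
    (p : Sph d) (t : ℝ) : Measurable (selection F w p t) :=
  Measurable.ite (measurableSet_le measurable_const hw) (hw.smul (measurable_nearest hF _))
    (hw.smul (measurable_nearest hF _))

/-- A set whose support function is dominated by the weighted mean of the support functions of `F`
lies in the Aumann mean of the weighted sets. -/
theorem subset_aumannMean_smul [IsProbabilityMeasure P]
    (hF : IsRandomSet fun ω => (F ω : Set (Euc d))) (hFB : ∀ ω, F ω ∈ KB d B)
    (hwm : Measurable w) (hw : MemLp w 2 P) {A : Set (Euc d)}
    (hA : ∀ a ∈ A, ∀ p : Sph d, inner ℝ (p : Euc d) a ≤ ∫ ω, w ω * supp (F ω) p ∂P) :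
    A ⊆ aumannMean P fun ω => w ω • (F ω : Set (Euc d)) := by
  have hwi : Integrable w P := hw.integrable (by norm_num)
  have hsel (p : Sph d) (t : ℝ) : Integrable (selection F w p t) P :=
    (hwi.abs.mul_const B).mono' (measurable_selection hF hwm p t).aestronglyMeasurable
      (Eventually.of_forall fun ω => norm_le_of_mem_smul hFB ω _ (selection_mem p t ω))
  have hmem (p : Sph d) (t : ℝ) :
      ∫ ω, selection F w p t ω ∂P ∈ aumannMean P fun ω => w ω • (F ω : Set (Euc d)) :=
    ⟨_, measurable_selection hF hwm p t, hsel p t,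
      Eventually.of_forall fun ω => selection_mem p t ω, rfl⟩
  have hconv : ∀ ω, Convex ℝ (w ω • (F ω : Set (Euc d))) := fun ω => (F ω).convex.smul _
  have hclosed : IsClosed (aumannMean P fun ω => w ω • (F ω : Set (Euc d))) :=
    isClosed_aumannMean hconv (fun ω => ((F ω).isCompact.smul _).isClosed)
      (hw.abs.mul_const B) (norm_le_of_mem_smul hFB)
  intro a ha
  by_contra hna
  have hne : (aumannMean P fun ω => w ω • (F ω : Set (Euc d))).Nonempty := by
    choose f hf using fun ω => (F ω).nonempty
    exact ⟨_, _, hwm.smul (measurable_nearest hF 0),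
      (hwi.abs.mul_const B).mono' (hwm.smul (measurable_nearest hF 0)).aestronglyMeasurable
      (Eventually.of_forall fun ω => norm_le_of_mem_smul hFB ω _
        (Set.smul_mem_smul_set (nearest_mem _ _))),
      Eventually.of_forall fun ω => Set.smul_mem_smul_set (nearest_mem _ _), rfl⟩
  obtain ⟨p, u, hu, hua⟩ := exists_sph_separating (convex_aumannMean hconv) hclosed hne hna
  -- Nearest points to `±(n + 1) • p` have an error of order `1 / (n + 1)`, which vanishes in the
  -- limit.
  have hlow (n : ℕ) : (∫ ω, w ω * supp (F ω) p ∂P) -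
      (∫ ω, |w ω| ∂P) * (B ^ 2 / 2) * (1 / ((n : ℝ) + 1)) ≤ u := by
    refine le_trans ?_ (hu _ (hmem p ((n : ℝ) + 1)))
    rw [← integral_inner (hsel p _), mul_assoc, ← integral_mul_const,
      ← integral_sub (integrable_mul_supp hF hFB hwi p) (hwi.abs.mul_const _)]
    refine integral_mono ((integrable_mul_supp hF hFB hwi p).sub (hwi.abs.mul_const _))
      ((hsel p _).const_inner _) fun ω => ?_
    have h := le_inner_selection (w := w) hFB p (t := (n : ℝ) + 1) (by positivity) ω
    have e : B ^ 2 / (2 * ((n : ℝ) + 1)) = B ^ 2 / 2 * (1 / ((n : ℝ) + 1)) := by field_simp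
    rwa [e] at h
  have hle : (∫ ω, w ω * supp (F ω) p ∂P) - (∫ ω, |w ω| ∂P) * (B ^ 2 / 2) * 0 ≤ u :=
    le_of_tendsto' ((tendsto_one_div_add_atTop_nhds_zero_nat.const_mul _).const_sub _) hlow
  rw [mul_zero, sub_zero] at hle
  linarith [hA a ha p]

/-- If the weighted `L²` mean of the support functions is the support function of `A`, then `A`
lies in the Aumann mean of the weighted sets. -/
theorem subset_aumannMean_smul_of_integral_eq_psi [IsProbabilityMeasure P]
    (hF : IsRandomSet fun ω => (F ω : Set (Euc d))) (hFB : ∀ ω, F ω ∈ KB d B)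
    (hwm : Measurable w) (hw : MemLp w 2 P) {A : ConvexBody (Euc d)}
    (hA : ∫ ω, w ω • psi (F ω) ∂P = psi A) :
    (A : Set (Euc d)) ⊆ aumannMean P fun ω => w ω • (F ω : Set (Euc d)) := by
  have hwi : Integrable w P := hw.integrable (by norm_num)
  have h : supp A = fun p => ∫ ω, w ω * supp (F ω) p ∂P :=
    eq_of_ae_eq_supp (continuous_integral_mul_supp hF hFB hwi)
      ((coeFn_psi A).symm.trans (hA ▸ integral_smul_psi_ae_eq hF hFB hwi))
  exact subset_aumannMean_smul hF hFB hwm hw fun a ha p =>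
    (inner_le_supp A p ha).trans_eq (congrFun h p)

end Inclusion

/-! ### The weight as a square integrable variable of mean one. -/

section Weight

variable {Ω : Type*} [MeasurableSpace Ω] {P : Measure Ω} {k : ℕ} {X : Ω → Euc k}

/-- Exhibits the weight as affine in `z`, centred at the mean; measurability, square integrability
and mean one all follow from this form. -/
theorem exists_weight_eq_inner (P : Measure Ω) (X : Ω → Euc k) (x : Euc k) :
    ∃ c : Euc k, ∀ z, weight P X x z = 1 + inner ℝ c (z - ∫ η, X η ∂P) := by
  refine ⟨WithLp.toLp 2 ((x - ∫ η, X η ∂P).ofLp ᵥ* (covMat P X)⁻¹), fun z => ?_⟩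
  rw [weight, Matrix.dotProduct_mulVec, EuclideanSpace.inner_eq_star_dotProduct, dotProduct_comm]
  simp

theorem measurable_weight (hX : Measurable X) (x : Euc k) :
    Measurable fun ω => weight P X x (X ω) := by
  obtain ⟨c, hc⟩ := exists_weight_eq_inner P X x
  have h : Continuous (weight P X x) := by
    rw [funext hc]
    fun_prop
  exact h.measurable.comp hX

theorem memLp_weight [IsProbabilityMeasure P] (hX2 : MemLp X 2 P) (x : Euc k) :
    MemLp (fun ω => weight P X x (X ω)) 2 P := by
  obtain ⟨c, hc⟩ := exists_weight_eq_inner P X x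
  have h1 : MemLp (fun ω => X ω - ∫ η, X η ∂P) 2 P := hX2.sub (memLp_const _)
  have h2 : MemLp (fun ω => (1 : ℝ) + inner ℝ c (X ω - ∫ η, X η ∂P)) 2 P :=
    (memLp_const (1 : ℝ)).add (h1.const_inner c)
  simpa only [hc] using h2

theorem integral_weight [IsProbabilityMeasure P] (hX2 : MemLp X 2 P) (x : Euc k) :
    ∫ ω, weight P X x (X ω) ∂P = 1 := by
  obtain ⟨c, hc⟩ := exists_weight_eq_inner P X x
  have hX : Integrable X P := hX2.integrable (by norm_num)
  have hXc : Integrable (fun ω => X ω - ∫ η, X η ∂P) P := hX.sub (integrable_const _)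
  simp_rw [hc]
  rw [integral_add (integrable_const _) (hXc.const_inner c), integral_inner hXc,
    integral_sub hX (integrable_const _)]
  simp

end Weight

/-! ### Weighted least squares and projection in a Hilbert space. -/

section Minimizer

/-- The weighted mean-square deviation around the weighted mean, for weights of total mass one. -/
theorem integral_mul_norm_sub_sq {Ω H : Type*} [MeasurableSpace Ω] {P : Measure Ω}
    [NormedAddCommGroup H] [InnerProductSpace ℝ H] [CompleteSpace H] {w : Ω → ℝ} {Y : Ω → H}
    (hw : Integrable w P) (hw1 : ∫ ω, w ω ∂P = 1) (hwY : Integrable (fun ω => w ω • Y ω) P)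
    (hwY2 : ∀ h, Integrable (fun ω => w ω * ‖h - Y ω‖ ^ 2) P) (h : H) :
    ∫ ω, w ω * ‖h - Y ω‖ ^ 2 ∂P = ‖h - ∫ ω, w ω • Y ω ∂P‖ ^ 2 +
      ((∫ ω, w ω * ‖0 - Y ω‖ ^ 2 ∂P) - ‖∫ ω, w ω • Y ω ∂P‖ ^ 2) := by
  have e (ω : Ω) : w ω * ‖h - Y ω‖ ^ 2 =
      w ω * ‖h‖ ^ 2 - 2 * inner ℝ h (w ω • Y ω) + w ω * ‖0 - Y ω‖ ^ 2 := by
    rw [norm_sub_sq_real, inner_smul_right, zero_sub, norm_neg]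
    ring
  have h1 : Integrable (fun ω => w ω * ‖h‖ ^ 2) P := hw.mul_const _
  have h2 : Integrable (fun ω => 2 * inner ℝ h (w ω • Y ω)) P := (hwY.const_inner h).const_mul 2
  rw [integral_congr_ae (Eventually.of_forall e),
    integral_add (f := fun ω => w ω * ‖h‖ ^ 2 - 2 * inner ℝ h (w ω • Y ω)) (h1.sub h2) (hwY2 0),
    integral_sub h1 h2, integral_mul_const, hw1, integral_const_mul, integral_inner hwY,
    norm_sub_sq_real]
  ring

/-- A closed convex nonempty set has a unique nearest point to `u`. -/
theorem exists_isUniqueMinimizer_norm_sub {H : Type*} [NormedAddCommGroup H]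
    [InnerProductSpace ℝ H] [CompleteSpace H] {K : Set H} (hne : K.Nonempty) (hcl : IsClosed K)
    (hK : Convex ℝ K) (u : H) : ∃ v, IsUniqueMinimizer (fun h => ‖h - u‖) K v := by
  obtain ⟨v, hv, h⟩ := exists_norm_eq_iInf_of_complete_convex hne hcl.isComplete hK u
  have hmin := (norm_eq_iInf_iff_real_inner_le_zero hK hv).1 h
  refine ⟨v, hv, fun b hb hbv => ?_⟩
  have h1 := hmin b hb
  have h2 := norm_sub_sq_real (u - v) (b - v)
  rw [sub_sub_sub_cancel_right] at h2
  have h3 : 0 < ‖b - v‖ := norm_pos_iff.2 (sub_ne_zero.2 hbv)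
  change ‖v - u‖ < ‖b - u‖
  rw [norm_sub_rev v, norm_sub_rev b]
  refine (pow_lt_pow_iff_left₀ (norm_nonneg _) (norm_nonneg _) two_ne_zero).1 ?_
  -- The variational inequality gives `‖u - b‖² ≥ ‖u - v‖² + ‖b - v‖²`.
  nlinarith

end Minimizer

end FrechetRS

end

/-! ### The proposition. -/

theorem proposition3 {Ω : Type*} [MeasurableSpace Ω] (P : Measure Ω) [IsProbabilityMeasure P]
    (d k : ℕ) (B : ℝ) (hB : 0 < B)
    (F : Ω → ConvexBody (FrechetRS.Euc d))
    (hF : FrechetRS.IsRandomSet fun ω => (F ω : Set (FrechetRS.Euc d)))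
    (hFB : ∀ ω, F ω ∈ FrechetRS.KB d B)
    (𝒳 : Set (FrechetRS.Euc k)) (X : Ω → FrechetRS.Euc k) (hX : Measurable X)
    (hX𝒳 : ∀ ω, X ω ∈ 𝒳) (hX2 : MemLp X 2 P)
    (hcov : IsUnit (FrechetRS.covMat P X))
    (x : FrechetRS.Euc k) :
    -- the weighted mean is a genuine expectation, and the weighted mean-square minimizer in `L²`
    Integrable (fun ω => FrechetRS.weight P X x (X ω) • FrechetRS.psi (F ω)) P ∧
    (∀ h : FrechetRS.L2Sph d,
      Integrable (fun ω => FrechetRS.weight P X x (X ω) * ‖h - FrechetRS.psi (F ω)‖ ^ 2) P) ∧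
    FrechetRS.IsUniqueMinimizer
      (fun h : FrechetRS.L2Sph d =>
        ∫ ω, FrechetRS.weight P X x (X ω) * ‖h - FrechetRS.psi (F ω)‖ ^ 2 ∂P)
      Set.univ (FrechetRS.weightedMean P F X x) ∧
    -- the criterion is well defined
    (∀ ν ∈ FrechetRS.KB d B,
      Integrable (fun ω => FrechetRS.weight P X x (X ω) * FrechetRS.dkc ν (F ω) ^ 2) P) ∧
    -- the projection `m'` of the weighted mean, and its pullback `M`
    ∃ m' : FrechetRS.L2Sph d,
      FrechetRS.IsUniqueMinimizer (fun h => ‖h - FrechetRS.weightedMean P F X x‖)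
        (FrechetRS.psi '' FrechetRS.KB d B) m' ∧
      ∃ M : ConvexBody (FrechetRS.Euc d),
        (M ∈ FrechetRS.KB d B ∧ FrechetRS.psi M = m' ∧
          ∀ N ∈ FrechetRS.KB d B, FrechetRS.psi N = m' → N = M) ∧
        -- `M` is the unique minimizer
        FrechetRS.IsUniqueMinimizer (FrechetRS.gfrCriterion P F X x) (FrechetRS.KB d B) M ∧
        -- inclusion in the Aumann mean
        (BddAbove ((fun z => |FrechetRS.weight P X x z|) '' 𝒳) →
          (FrechetRS.weightedMean P F X x ∈ FrechetRS.psi '' FrechetRS.KB d B →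
            (M : Set (FrechetRS.Euc d)) ⊆ FrechetRS.aumannMean P
              fun ω => FrechetRS.weight P X x (X ω) • (F ω : Set (FrechetRS.Euc d))) ∧
          ∀ A : ConvexBody (FrechetRS.Euc d),
            FrechetRS.weightedMean P F X x = FrechetRS.psi A →
            (A : Set (FrechetRS.Euc d)) ⊆ FrechetRS.aumannMean P
              fun ω => FrechetRS.weight P X x (X ω) • (F ω : Set (FrechetRS.Euc d))) := by
  set w := fun ω => FrechetRS.weight P X x (X ω) with hw
  have hwm : Measurable w := FrechetRS.measurable_weight hX x
  have hw2 : MemLp w 2 P := FrechetRS.memLp_weight hX2 x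
  have hwi : Integrable w P := hw2.integrable (by norm_num)
  have hint := FrechetRS.integrable_smul_psi hF hFB hwi
  have hint2 := FrechetRS.integrable_mul_norm_sub_psi_sq hF hFB hwi
  set m := FrechetRS.weightedMean P F X x with hm
  have hdec (h : FrechetRS.L2Sph d) := FrechetRS.integral_mul_norm_sub_sq hwi
    (FrechetRS.integral_weight hX2 x) hint hint2 h
  change ∀ h, _ = ‖h - m‖ ^ 2 + _ at hdec
  have hcrit (ν : ConvexBody (FrechetRS.Euc d)) :
      FrechetRS.gfrCriterion P F X x ν =
        ∫ ω, w ω * ‖FrechetRS.psi ν - FrechetRS.psi (F ω)‖ ^ 2 ∂P := by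
    simp_rw [FrechetRS.gfrCriterion, FrechetRS.dkc_sq, hw]
  have hne : (FrechetRS.psi '' FrechetRS.KB d B).Nonempty := by
    refine ⟨_, 0, fun f hf => ?_, rfl⟩
    rw [ConvexBody.coe_zero, Set.mem_zero] at hf
    rw [hf, norm_zero]
    exact hB.le
  obtain ⟨m', ⟨M, hM, rfl⟩, hmin⟩ := FrechetRS.exists_isUniqueMinimizer_norm_sub hne
    (FrechetRS.isClosed_image_psi_KB B) (FrechetRS.convex_image_psi_KB B) m
  have hincl (A : ConvexBody (FrechetRS.Euc d)) (hA : m = FrechetRS.psi A) :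
      (A : Set (FrechetRS.Euc d)) ⊆ FrechetRS.aumannMean P
        fun ω => FrechetRS.weight P X x (X ω) • (F ω : Set (FrechetRS.Euc d)) :=
    FrechetRS.subset_aumannMean_smul_of_integral_eq_psi hF hFB hwm hw2 hA
  refine ⟨hint, hint2, ⟨Set.mem_univ _, fun b _ hb => ?_⟩, fun ν _ => ?_, FrechetRS.psi M,
    ⟨⟨M, hM, rfl⟩, hmin⟩, M, ⟨hM, rfl, fun N _ hN => FrechetRS.psi_injective hN⟩,
    ⟨hM, fun N hN hNM => ?_⟩, fun _ => ⟨fun hmK => hincl M ?_, hincl⟩⟩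
  · change ∫ ω, w ω * ‖m - FrechetRS.psi (F ω)‖ ^ 2 ∂P <
      ∫ ω, w ω * ‖b - FrechetRS.psi (F ω)‖ ^ 2 ∂P
    rw [hdec, hdec b, sub_self, norm_zero]
    have : 0 < ‖b - m‖ := norm_pos_iff.2 (sub_ne_zero.2 hb)
    gcongr
  · simp_rw [FrechetRS.dkc_sq]
    exact hint2 _
  · rw [hcrit, hcrit, hdec, hdec (FrechetRS.psi N)]
    have := hmin _ ⟨N, hN, rfl⟩ (FrechetRS.psi_injective.ne hNM)
    simp only at this
    gcongr
  -- If `m` itself lies in the image, it is at distance zero, so the projection is `m`.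
  · by_contra hne
    have := hmin m hmK hne
    simp only [sub_self, norm_zero] at this
    exact absurd this (not_lt.2 (norm_nonneg _))
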